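/- Let $Sp(2)=\{Q\in M(2,\mathbb H)\mid QQ^*=I\}$, where $\mathbb H$ is the algebra of quaternions and $Q^*$ the conjugate transpose, so that $$T_QSp(2)=\Big\{Q\begin{pmatrix}x&y\\-\bar y&z\end{pmatrix}\ \Big|\ x,y,z\in\mathbb H,\ \mathrm{Re}(x)=\mathrm{Re}(z)=0\Big\}.$$ Let $r_1,r_2>0$ be real numbers and let $g_r=g_{(r_1,r_2)}$ be the left-invariant Riemannian metric on $Sp(2)$ with $$\Big|Q\begin{pmatrix}x&y\\-\bar y&z\end{pmatrix}\Big|^2_{g_r}=\frac{r_1}{2}|x|^2+|y|^2+\frac{r_2}{2}|z|^2 .$$ Consider the Levi-Civita connection of $g_r$ (which exists) and its curvature. Then: (1) the sectional curvature of $g_r$ is nonnegative (for all points and all tangent planes) if and only if $r_1+r_2\le 2$; (2) $g_r$ is Einstein, that is, $\mathrm{Ric}=c\,g_r$ for some real constant $c$, if and only if $r_1=r_2=1$ or $r_1=r_2=\tfrac12$. -/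

import Mathlib

open scoped Quaternion Matrix ContDiff

noncomputable section

namespace SpTwo

/-- The real vector space `M(2, ℍ)` of `2 × 2` quaternionic matrices. -/
abbrev MatH : Type := Matrix (Fin 2) (Fin 2) ℍ[ℝ]

section Norm

/-! A norm on the finite-dimensional space `M(2, ℍ)`, needed to speak of derivatives; all norms
being equivalent, smoothness and derivatives do not depend on the choice. -/

attribute [local instance] Matrix.linftyOpNormedRing Matrix.linftyOpNormedAlgebra

/-- The compact symplectic group `Sp(2) = {Q ∈ M(2, ℍ) | Q Q* = Q* Q = I}`, as a closed
submanifold of `M(2, ℍ)`. -/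
def Sp2 : Submonoid MatH := unitary MatH

/-- The Lie algebra `𝔰𝔭(2) = {A | A* = -A}`. The condition `A* = -A` says that
`A = (x, y; -ȳ, z)` with `Re x = Re z = 0`. -/
def sp2 : Submodule ℝ MatH where
  carrier := {A | Aᴴ = -A}
  add_mem' := by
    intro A B hA hB
    simp only [Set.mem_ofPred_eq] at hA hB ⊢
    rw [Matrix.conjTranspose_add, hA, hB, neg_add]
  zero_mem' := by simp
  smul_mem' := by
    intro c A hA
    simp only [Set.mem_ofPred_eq] at hA ⊢
    rw [← smul_neg, ← hA]
    ext1 i j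
    simp [Matrix.conjTranspose_apply]

/-- The tangent space `T_Q Sp(2) = {Q A | A ∈ 𝔰𝔭(2)}`. -/
def tangentSpace (Q : MatH) : Submodule ℝ MatH :=
  sp2.map (LinearMap.mulLeft ℝ Q)

/-- The left-invariant metric `g_r` on `Sp(2)`: for `v = Q A` and `w = Q B`, that is, `A = Q* v`
and `B = Q* w`, it is the polarization of
`|Q (x, y; -ȳ, z)|² = (r₁/2) |x|² + |y|² + (r₂/2) |z|²`. -/
def metric (r₁ r₂ : ℝ) (Q v w : MatH) : ℝ :=
  r₁ / 2 * inner ℝ ((Qᴴ * v) 0 0) ((Qᴴ * w) 0 0)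
    + inner ℝ ((Qᴴ * v) 0 1) ((Qᴴ * w) 0 1)
    + r₂ / 2 * inner ℝ ((Qᴴ * v) 1 1) ((Qᴴ * w) 1 1)

/-- Smooth vector fields on `Sp(2)`. Since `Sp(2)` is a closed submanifold of `M(2, ℍ)`, every
smooth vector field (and every smooth function) on it is the restriction of a smooth map defined on
all of `M(2, ℍ)`; a vector field is represented by such a map `X`, tangent to `Sp(2)` at the points
of `Sp(2)`. Only the restriction to `Sp(2)` is meaningful: derivatives are only ever evaluated at
points of `Sp(2)` in directions tangent to `Sp(2)`, and the Lie bracket of two such maps restricts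
on `Sp(2)` to the Lie bracket of the restrictions. -/
structure IsVectorField (X : MatH → MatH) : Prop where
  smooth : ContDiff ℝ ∞ X
  tangent : ∀ Q ∈ Sp2, X Q ∈ tangentSpace Q

/-- `nabla X Y = ∇_X Y` is the Levi-Civita connection on `Sp(2)` of the Riemannian metric `g`:
an affine connection which is torsion-free and compatible with the metric. -/
structure IsLeviCivita (g : MatH → MatH → MatH → ℝ)
    (nabla : (MatH → MatH) → (MatH → MatH) → (MatH → MatH)) : Prop where
  isVectorField : ∀ X Y, IsVectorField X → IsVectorField Y → IsVectorField (nabla X Y)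
  add_left : ∀ X X' Y, IsVectorField X → IsVectorField X' → IsVectorField Y →
    ∀ Q ∈ Sp2, nabla (X + X') Y Q = nabla X Y Q + nabla X' Y Q
  smul_left : ∀ (f : MatH → ℝ) (X Y), ContDiff ℝ ∞ f → IsVectorField X → IsVectorField Y →
    ∀ Q ∈ Sp2, nabla (fun P => f P • X P) Y Q = f Q • nabla X Y Q
  add_right : ∀ X Y Y', IsVectorField X → IsVectorField Y → IsVectorField Y' →
    ∀ Q ∈ Sp2, nabla X (Y + Y') Q = nabla X Y Q + nabla X Y' Q
  leibniz : ∀ (f : MatH → ℝ) (X Y), ContDiff ℝ ∞ f → IsVectorField X → IsVectorField Y →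
    ∀ Q ∈ Sp2, nabla X (fun P => f P • Y P) Q
      = f Q • nabla X Y Q + fderiv ℝ f Q (X Q) • Y Q
  torsion_free : ∀ X Y, IsVectorField X → IsVectorField Y →
    ∀ Q ∈ Sp2, nabla X Y Q - nabla Y X Q = VectorField.lieBracket ℝ X Y Q
  metric_compatible : ∀ X Y Z, IsVectorField X → IsVectorField Y → IsVectorField Z →
    ∀ Q ∈ Sp2, fderiv ℝ (fun P => g P (Y P) (Z P)) Q (X Q)
      = g Q (nabla X Y Q) (Z Q) + g Q (Y Q) (nabla X Z Q)

/-- The curvature `R(X, Y) Z = ∇_X ∇_Y Z - ∇_Y ∇_X Z - ∇_{[X, Y]} Z` of a connection. -/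
def curvature (nabla : (MatH → MatH) → (MatH → MatH) → (MatH → MatH))
    (X Y Z : MatH → MatH) : MatH → MatH :=
  nabla X (nabla Y Z) - nabla Y (nabla X Z) - nabla (VectorField.lieBracket ℝ X Y) Z

/-- The left-invariant vector field `P ↦ P Q* v`, whose value at `Q ∈ Sp(2)` is `v`. -/
def leftInvariantField (Q v : MatH) : MatH → MatH := fun P => P * (Qᴴ * v)

/-- The curvature tensor `R_Q(u, v) w` for `u, v, w ∈ T_Q Sp(2)`. The curvature being tensorial,
it may be computed with any vector fields extending `u, v, w`; here the left-invariant ones. -/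
def curvatureTensor (nabla : (MatH → MatH) → (MatH → MatH) → (MatH → MatH))
    (Q u v w : MatH) : MatH :=
  curvature nabla (leftInvariantField Q u) (leftInvariantField Q v) (leftInvariantField Q w) Q

/-- The sectional curvature of the plane spanned by two linearly independent tangent vectors
`u, v ∈ T_Q Sp(2)`. -/
def sectionalCurvature (g : MatH → MatH → MatH → ℝ)
    (nabla : (MatH → MatH) → (MatH → MatH) → (MatH → MatH)) (Q u v : MatH) : ℝ :=
  g Q (curvatureTensor nabla Q u v v) u / (g Q u u * g Q v v - g Q u v ^ 2)

/-- All sectional curvatures of `Sp(2)` are nonnegative. -/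
def NonnegSectionalCurvature (g : MatH → MatH → MatH → ℝ)
    (nabla : (MatH → MatH) → (MatH → MatH) → (MatH → MatH)) : Prop :=
  ∀ Q ∈ Sp2, ∀ u ∈ tangentSpace Q, ∀ v ∈ tangentSpace Q, LinearIndependent ℝ ![u, v] →
    0 ≤ sectionalCurvature g nabla Q u v

/-- `Ric_Q(v, w) = ρ`: the map `u ↦ R_Q(u, v) w` is an endomorphism of `T_Q Sp(2)` with
trace `ρ`. -/
def HasRicci (nabla : (MatH → MatH) → (MatH → MatH) → (MatH → MatH)) (Q v w : MatH) (ρ : ℝ) :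
    Prop :=
  ∃ T : Module.End ℝ (tangentSpace Q),
    (∀ u : tangentSpace Q, (T u : MatH) = curvatureTensor nabla Q u v w) ∧
      LinearMap.trace ℝ (tangentSpace Q) T = ρ

/-- The Einstein condition `Ric = c g` for some constant `c`. -/
def IsEinstein (g : MatH → MatH → MatH → ℝ)
    (nabla : (MatH → MatH) → (MatH → MatH) → (MatH → MatH)) : Prop :=
  ∃ c : ℝ, ∀ Q ∈ Sp2, ∀ v ∈ tangentSpace Q, ∀ w ∈ tangentSpace Q,
    HasRicci nabla Q v w (c * g Q v w)

end Norm

end SpTwo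

end

/-!
The connection is computed in the left trivialization `T Sp(2) = Sp(2) × 𝔰𝔭(2)`. Write elements of
`𝔰𝔭(2)` as triples `(x, y, z)`, with `x` and `z` imaginary quaternions.

*Existence.* The Koszul formula at the identity has an explicit solution, a bilinear product `Λ` on
`𝔰𝔭(2)` (`lcProduct`) with `Λ(a, b) - Λ(b, a) = [a, b]` and `Λ(a, ·)` skew for the metric. For
vector fields written as `X = P A(P)` and `Y = P B(P)`, with `A` and `B` valued in `𝔰𝔭(2)`, the
formula `∇_X Y = P (dB(X) + Λ(A, B))` defines the Levi-Civita connection. This part only uses that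
`Sp(2)` is the unitary group of a finite-dimensional star algebra. Fields are maps on the whole
algebra, so one needs that derivatives in tangent directions only see the values on the group
(`fderiv_eq_zero_of_unitary`), which follows by differentiating along `Q exp (t A)`.

*Uniqueness.* For any Levi-Civita connection, `∇_X Y` on `Sp(2)` only depends on `Y` on `Sp(2)`
(`IsLeviCivita.congr_right`), and on left-invariant fields it is given by `Λ`
(`IsLeviCivita.nabla_leftField`). Hence the curvature tensor is the left translate of
`R(a, b) c = Λ(a, Λ(b, c)) - Λ(b, Λ(a, c)) - Λ([a, b], c)`.

*Sectional curvature.* The numerator is (`form_curv_mk`)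
`r₁/8 |[x, x'] + (3 - 2 r₁) C|² + r₂/8 |[z, z'] + (3 - 2 r₂) C'|²`
`+ 1/4 |r₁ (x y' - x' y) + r₂ (y z' - y' z)|² + ((1 - r₁)³ + (1 - r₂)³)/2 |C|²`,
where `C = y' ȳ - y ȳ'` and `C' = ȳ' y - ȳ y'` have the same norm. As `(1 - r₁)³ + (1 - r₂)³` has
the sign of `2 - r₁ - r₂`, the curvature is nonnegative when `r₁ + r₂ ≤ 2`; conversely there is
always a plane with `C ≠ 0` on which the three squares vanish (`exists_form_curv_eq`).

*Ricci curvature.* Taking traces in coordinates (`sum_coords_curv`),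
`Ric = (2 + r₁²) |x|² + (12 - 3 (r₁ + r₂)) |y|² + (2 + r₂²) |z|²`, and comparing with
`c (r₁/2 |x|² + |y|² + r₂/2 |z|²)` leaves the two solutions (`einstein_constants_iff`).
-/

noncomputable section

namespace UnitaryConnection

/-! ### Left-invariant connections on the unitary group of a star algebra -/

variable {𝔸 : Type*} [NormedRing 𝔸] [NormedAlgebra ℝ 𝔸] [StarRing 𝔸]

variable {X X' Y Y' Z : 𝔸 → 𝔸} {Q : 𝔸}

/-- The left trivialization `P ↦ P* X(P)` of a vector field `X`, made skew-adjoint at all points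
of the algebra and not only on the unitary group. -/
def trivialize (X : 𝔸 → 𝔸) (P : 𝔸) : 𝔸 := (1 / 2 : ℝ) • (star P * X P - star (star P * X P))

/-- A vector field on the unitary group, represented by a smooth map on the whole algebra. Tangency
`X(Q) ∈ Q 𝔲` is stated after left translation to the identity, where `𝔲` is the space of
skew-adjoint elements. -/
structure IsField (X : 𝔸 → 𝔸) : Prop where
  smooth : ContDiff ℝ ∞ X
  skew : ∀ Q ∈ unitary 𝔸, star Q * X Q ∈ skewAdjoint 𝔸

theorem half_sub_star_eq {a : 𝔸} (ha : a ∈ skewAdjoint 𝔸) : (1 / 2 : ℝ) • (a - star a) = a := by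
  rw [skewAdjoint.mem_iff.1 ha, sub_neg_eq_add, ← two_smul ℝ a, smul_smul]
  norm_num

theorem IsField.trivialize_eq (hX : IsField X) (hQ : Q ∈ unitary 𝔸) :
    trivialize X Q = star Q * X Q :=
  half_sub_star_eq (hX.skew Q hQ)

theorem IsField.mul_trivialize (hX : IsField X) (hQ : Q ∈ unitary 𝔸) :
    Q * trivialize X Q = X Q := by
  rw [hX.trivialize_eq hQ, ← mul_assoc, Unitary.mul_star_self_of_mem hQ, one_mul]

theorem IsField.differentiableAt (hX : IsField X) : DifferentiableAt ℝ X Q :=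
  hX.smooth.differentiable (by simp) Q

theorem trivialize_add (X X' : 𝔸 → 𝔸) : trivialize (X + X') = trivialize X + trivialize X' := by
  funext P
  simp only [trivialize, Pi.add_apply, mul_add, star_add, ← smul_add]
  congr 1
  abel

/-- The affine connection whose left-invariant part is the bilinear map `Λ`: in the left
trivialization, `∇_X Y` is the derivative of `Y` along `X` plus `Λ(X, Y)`. -/
def connection (Λ : 𝔸 →ₗ[ℝ] 𝔸 →ₗ[ℝ] 𝔸) (X Y : 𝔸 → 𝔸) (P : 𝔸) : 𝔸 :=
  P * (fderiv ℝ (trivialize Y) P (X P) + Λ (trivialize X P) (trivialize Y P))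

variable {Λ : 𝔸 →ₗ[ℝ] 𝔸 →ₗ[ℝ] 𝔸}

theorem connection_add_left : connection Λ (X + X') Y Q
    = connection Λ X Y Q + connection Λ X' Y Q := by
  simp only [connection, trivialize_add, Pi.add_apply, map_add, LinearMap.add_apply, ← mul_add]
  congr 1
  abel

theorem fderiv_mul_const_apply {R : Type*} [NormedRing R] [NormedAlgebra ℝ R] (a Q v : R) :
    fderiv ℝ (fun P : R => P * a) Q v = v * a := by
  have h : HasFDerivAt (fun P : R => P * a) _ Q := (hasFDerivAt_id (𝕜 := ℝ) Q).mul_const' a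
  rw [h.fderiv]
  rfl

variable [StarModule ℝ 𝔸]

theorem half_sub_star_mem (a : 𝔸) : (1 / 2 : ℝ) • (a - star a) ∈ skewAdjoint 𝔸 := by
  rw [skewAdjoint.mem_iff, star_smul, star_sub, star_star, star_trivial, ← smul_neg, neg_sub]

theorem trivialize_mem (X : 𝔸 → 𝔸) (P : 𝔸) : trivialize X P ∈ skewAdjoint 𝔸 :=
  half_sub_star_mem _

theorem trivialize_smul (f : 𝔸 → ℝ) (X : 𝔸 → 𝔸) :
    trivialize (fun P => f P • X P) = fun P => f P • trivialize X P := by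
  funext P
  simp only [trivialize, mul_smul_comm, star_smul, star_trivial, ← smul_sub, smul_comm (f P)]

theorem connection_smul_left (f : 𝔸 → ℝ) : connection Λ (fun P => f P • X P) Y Q
    = f Q • connection Λ X Y Q := by
  simp only [connection, trivialize_smul, map_smul, LinearMap.smul_apply, ← smul_add,
    mul_smul_comm]

variable [FiniteDimensional ℝ 𝔸] {E : Type*} [NormedAddCommGroup E] [NormedSpace ℝ E]

variable (𝔸) in
/-- The conjugation of a finite-dimensional real star algebra, as a continuous linear map. -/
def starMap : 𝔸 →L[ℝ] 𝔸 :=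
  LinearMap.toContinuousLinearMap
    { toFun := star, map_add' := star_add, map_smul' := fun c a => by simp [star_smul] }

/-- The curve `t ↦ Q exp (t A)` stays in the unitary group when `A` is skew-adjoint, so the
derivative of a function in the direction `Q A` only depends on its values on that group. -/
theorem fderiv_eq_zero_of_unitary {F : 𝔸 → E} (hF : ∀ P ∈ unitary 𝔸, F P = 0) {A : 𝔸}
    (hd : DifferentiableAt ℝ F Q) (hQ : Q ∈ unitary 𝔸) (hA : A ∈ skewAdjoint 𝔸) :
    fderiv ℝ F Q (Q * A) = 0 := by
  have : CompleteSpace 𝔸 := FiniteDimensional.complete ℝ 𝔸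
  have : ContinuousStar 𝔸 := ⟨(starMap 𝔸).continuous⟩
  let _ := NormedAlgebra.restrictScalars ℚ ℝ 𝔸
  have h1 : HasDerivAt (fun t : ℝ => Q * NormedSpace.exp (t • A)) (Q * A) 0 := by
    simpa using (hasDerivAt_exp_smul_const A (0 : ℝ)).const_mul Q
  have h2 : HasDerivAt (fun t : ℝ => F (Q * NormedSpace.exp (t • A))) (fderiv ℝ F Q (Q * A)) 0 := by
    refine HasFDerivAt.comp_hasDerivAt (f := fun t : ℝ => Q * NormedSpace.exp (t • A)) 0 ?_ h1
    simpa using hd.hasFDerivAt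
  have h3 : (fun t : ℝ => F (Q * NormedSpace.exp (t • A))) = fun _ => 0 := funext fun t =>
    hF _ (mul_mem hQ (NormedSpace.exp_mem_unitary_of_mem_skewAdjoint (skewAdjoint.smul_mem t hA)))
  rw [h3] at h2
  exact h2.unique (hasDerivAt_const _ _)

theorem fderiv_congr_of_unitary {F G : 𝔸 → E} (hFG : ∀ P ∈ unitary 𝔸, F P = G P) {A : 𝔸}
    (hF : DifferentiableAt ℝ F Q) (hG : DifferentiableAt ℝ G Q) (hQ : Q ∈ unitary 𝔸)
    (hA : A ∈ skewAdjoint 𝔸) : fderiv ℝ F Q (Q * A) = fderiv ℝ G Q (Q * A) := by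
  have h := fderiv_eq_zero_of_unitary (F := fun P => F P - G P)
    (fun P hP => sub_eq_zero.2 (hFG P hP)) (hF.sub hG) hQ hA
  rw [fderiv_fun_sub hF hG] at h
  exact sub_eq_zero.1 h

theorem contDiff_star_mul (hX : ContDiff ℝ ∞ X) : ContDiff ℝ ∞ fun P => star P * X P :=
  (starMap 𝔸).contDiff.mul hX

theorem contDiff_trivialize (hX : ContDiff ℝ ∞ X) : ContDiff ℝ ∞ (trivialize X) :=
  ((contDiff_star_mul hX).sub ((starMap 𝔸).contDiff.comp (contDiff_star_mul hX))).const_smul _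

theorem IsField.differentiableAt_trivialize (hX : IsField X) :
    DifferentiableAt ℝ (trivialize X) Q :=
  (contDiff_trivialize hX.smooth).differentiable (by simp) Q

/-- Being valued in the closed subspace of skew-adjoint elements, the trivialization has a
skew-adjoint derivative. -/
theorem fderiv_trivialize_mem (hX : ContDiff ℝ ∞ X) (Q v : 𝔸) :
    fderiv ℝ (trivialize X) Q v ∈ skewAdjoint 𝔸 := by
  have hd : DifferentiableAt ℝ (fun P => star P * X P) Q :=
    (contDiff_star_mul hX).differentiable (by simp) Q
  have h : HasFDerivAt (trivialize X) ((1 / 2 : ℝ) • (fderiv ℝ (fun P => star P * X P) Q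
      - (starMap 𝔸).comp (fderiv ℝ (fun P => star P * X P) Q))) Q :=
    (hd.hasFDerivAt.sub ((starMap 𝔸).hasFDerivAt.comp Q hd.hasFDerivAt)).const_smul (1 / 2 : ℝ)
  rw [h.fderiv]
  exact half_sub_star_mem _

theorem isField_connection (hΛ : ∀ a ∈ skewAdjoint 𝔸, ∀ b ∈ skewAdjoint 𝔸, Λ a b ∈ skewAdjoint 𝔸)
    (hX : IsField X) (hY : IsField Y) : IsField (connection Λ X Y) := by
  refine ⟨contDiff_id.mul (((contDiff_trivialize hY.smooth).fderiv_right (by simp)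
    |>.clm_apply hX.smooth).add ?_), fun Q hQ => ?_⟩
  · exact (Λ.toContinuousBilinearMap.contDiff.comp (contDiff_trivialize hX.smooth)).clm_apply
      (contDiff_trivialize hY.smooth)
  · rw [connection, ← mul_assoc, Unitary.star_mul_self_of_mem hQ, one_mul]
    exact add_mem (fderiv_trivialize_mem hY.smooth Q _)
      (hΛ _ (trivialize_mem X Q) _ (trivialize_mem Y Q))

theorem connection_add_right (hY : IsField Y) (hY' : IsField Y') :
    connection Λ X (Y + Y') Q = connection Λ X Y Q + connection Λ X Y' Q := by
  simp only [connection, trivialize_add,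
    fderiv_add hY.differentiableAt_trivialize hY'.differentiableAt_trivialize, Pi.add_apply,
    map_add, add_apply, ← mul_add]
  congr 1
  abel

theorem connection_leibniz {f : 𝔸 → ℝ} (hf : ContDiff ℝ ∞ f) (hY : IsField Y)
    (hQ : Q ∈ unitary 𝔸) : connection Λ X (fun P => f P • Y P) Q
      = f Q • connection Λ X Y Q + fderiv ℝ f Q (X Q) • Y Q := by
  rw [← hY.mul_trivialize hQ]
  simp only [connection, trivialize_smul,
    fderiv_fun_smul (hf.differentiable (by simp) Q) hY.differentiableAt_trivialize,
    add_apply, smul_apply,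
    ContinuousLinearMap.smulRight_apply, map_smul, ← mul_smul_comm, ← mul_add, smul_add]
  congr 1
  abel

/-- The Leibniz rule for `Y = P B(P)`, valid in tangent directions although `Y(P) = P B(P)` only
holds on the unitary group. -/
theorem IsField.fderiv_eq (hX : IsField X) (hY : IsField Y) (hQ : Q ∈ unitary 𝔸) :
    fderiv ℝ Y Q (X Q) = Q * fderiv ℝ (trivialize Y) Q (X Q) + X Q * trivialize Y Q := by
  have h : HasFDerivAt (fun P => P * trivialize Y P) _ Q :=
    (hasFDerivAt_id Q).mul' hY.differentiableAt_trivialize.hasFDerivAt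
  have h2 := fderiv_congr_of_unitary (F := Y) (G := fun P => P * trivialize Y P)
    (fun P hP => (hY.mul_trivialize hP).symm) hY.differentiableAt h.differentiableAt hQ
    (trivialize_mem X Q)
  rw [hX.mul_trivialize hQ, h.fderiv] at h2
  simpa using h2

theorem connection_torsion_free
    (hΛ : ∀ a ∈ skewAdjoint 𝔸, ∀ b ∈ skewAdjoint 𝔸, Λ a b - Λ b a = a * b - b * a)
    (hX : IsField X) (hY : IsField Y) (hQ : Q ∈ unitary 𝔸) :
    connection Λ X Y Q - connection Λ Y X Q = fderiv ℝ Y Q (X Q) - fderiv ℝ X Q (Y Q) := by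
  have h := hΛ _ (trivialize_mem X Q) _ (trivialize_mem Y Q)
  have hX' : X Q * trivialize Y Q = Q * (trivialize X Q * trivialize Y Q) := by
    rw [← mul_assoc, hX.mul_trivialize hQ]
  have hY' : Y Q * trivialize X Q = Q * (trivialize Y Q * trivialize X Q) := by
    rw [← mul_assoc, hY.mul_trivialize hQ]
  rw [sub_eq_iff_eq_add] at h
  rw [hX.fderiv_eq hY hQ, hY.fderiv_eq hX hQ, hX', hY', connection, connection, h]
  noncomm_ring

theorem differentiableAt_form (β : 𝔸 →ₗ[ℝ] 𝔸 →ₗ[ℝ] ℝ) (hY : ContDiff ℝ ∞ Y)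
    (hZ : ContDiff ℝ ∞ Z) : DifferentiableAt ℝ (fun P => β (star P * Y P) (star P * Z P)) Q :=
  (β.toContinuousBilinearMap.hasFDerivAt_of_bilinear
    ((contDiff_star_mul hY).differentiable (by simp) Q).hasFDerivAt
    ((contDiff_star_mul hZ).differentiable (by simp) Q).hasFDerivAt).differentiableAt

theorem connection_metric_compatible {β : 𝔸 →ₗ[ℝ] 𝔸 →ₗ[ℝ] ℝ}
    (hΛ : ∀ a ∈ skewAdjoint 𝔸, ∀ b ∈ skewAdjoint 𝔸, ∀ c ∈ skewAdjoint 𝔸,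
      β (Λ a b) c + β b (Λ a c) = 0)
    (hX : IsField X) (hY : IsField Y) (hZ : IsField Z) (hQ : Q ∈ unitary 𝔸) :
    fderiv ℝ (fun P => β (star P * Y P) (star P * Z P)) Q (X Q)
      = β (star Q * connection Λ X Y Q) (star Q * Z Q)
        + β (star Q * Y Q) (star Q * connection Λ X Z Q) := by
  have h2 : HasFDerivAt (fun P => β (trivialize Y P) (trivialize Z P)) _ Q :=
    β.toContinuousBilinearMap.hasFDerivAt_of_bilinear
      hY.differentiableAt_trivialize.hasFDerivAt hZ.differentiableAt_trivialize.hasFDerivAt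
  have h3 := fderiv_congr_of_unitary (fun P hP => by
    rw [hY.trivialize_eq hP, hZ.trivialize_eq hP])
    (differentiableAt_form β hY.smooth hZ.smooth) h2.differentiableAt hQ (trivialize_mem X Q)
  rw [hX.mul_trivialize hQ, h2.fderiv] at h3
  rw [h3, connection, connection, ← mul_assoc, ← mul_assoc, Unitary.star_mul_self_of_mem hQ,
    one_mul, one_mul, ← hY.trivialize_eq hQ, ← hZ.trivialize_eq hQ]
  have h4 := hΛ _ (trivialize_mem X Q) _ (trivialize_mem Y Q) _ (trivialize_mem Z Q)
  simp only [map_add, LinearMap.add_apply, add_apply,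
    ContinuousLinearMap.precompR_apply, ContinuousLinearMap.precompL_apply,
    ContinuousLinearMap.compL_apply, ContinuousLinearMap.comp_apply,
    LinearMap.toContinuousBilinearMap_apply]
  linarith

end UnitaryConnection

namespace SpTwo

/-! ### The Lie algebra and its Levi-Civita product -/

/-- The quaternion with given components. -/
def quat (a b c d : ℝ) : ℍ[ℝ] := ⟨a, b, c, d⟩

section quat
variable (a b c d : ℝ)
@[simp] theorem quat_re : (quat a b c d).re = a := rfl
@[simp] theorem quat_imI : (quat a b c d).imI = b := rfl
@[simp] theorem quat_imJ : (quat a b c d).imJ = c := rfl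
@[simp] theorem quat_imK : (quat a b c d).imK = d := rfl
end quat

/-- The matrix `(x, y; -ȳ, z)`, an element of `𝔰𝔭(2)` when `x` and `z` are imaginary. -/
def mk (x y z : ℍ[ℝ]) : MatH := !![x, y; -star y, z]

section mk
variable (x y z x' y' z' : ℍ[ℝ]) (c : ℝ)

@[simp] theorem mk_apply₀₀ : mk x y z 0 0 = x := rfl
@[simp] theorem mk_apply₀₁ : mk x y z 0 1 = y := rfl
@[simp] theorem mk_apply₁₁ : mk x y z 1 1 = z := rfl

theorem mk_add : mk x y z + mk x' y' z' = mk (x + x') (y + y') (z + z') := by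
  simp [mk, add_comm]

theorem mk_sub : mk x y z - mk x' y' z' = mk (x - x') (y - y') (z - z') := by
  simp [mk, sub_eq_add_neg, add_comm]

theorem mk_smul : c • mk x y z = mk (c • x) (c • y) (c • z) := by
  simp [mk]

theorem mk_mem_sp2 {x z : ℍ[ℝ]} (hx : x.re = 0) (y : ℍ[ℝ]) (hz : z.re = 0) : mk x y z ∈ sp2 := by
  rw [← Quaternion.star_eq_neg] at hx hz
  change (mk x y z)ᴴ = -mk x y z
  ext1 i j
  fin_cases i <;> fin_cases j <;> simp [mk, hx, hz]

theorem exists_eq_mk {A : MatH} (hA : A ∈ sp2) :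
    ∃ x y z : ℍ[ℝ], x.re = 0 ∧ z.re = 0 ∧ A = mk x y z := by
  have h (i j) : star (A j i) = -A i j := congrFun (congrFun (show Aᴴ = -A from hA) i) j
  refine ⟨A 0 0, A 0 1, A 1 1, Quaternion.star_eq_neg.1 (h 0 0),
    Quaternion.star_eq_neg.1 (h 1 1), ?_⟩
  ext1 i j
  fin_cases i <;> fin_cases j <;> simp [mk, h]

theorem mk_commutator {x z x' z' : ℍ[ℝ]} (y y' : ℍ[ℝ]) (hx : x.re = 0) (hz : z.re = 0)
    (hx' : x'.re = 0) (hz' : z'.re = 0) : mk x y z * mk x' y' z' - mk x' y' z' * mk x y z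
    = mk (x * x' - x' * x - y * star y' + y' * star y) (x * y' + y * z' - x' * y - y' * z)
      (z * z' - z' * z - star y * y' + star y' * y) := by
  rw [← Quaternion.star_eq_neg] at hx hz hx' hz'
  ext1 i j
  fin_cases i <;> fin_cases j <;> simp [mk, hx, hz, hx', hz'] <;> abel

end mk

/-- The value at the identity of the metric `g_r`, as a bilinear form on `M(2, ℍ)`. -/
def form (r₁ r₂ : ℝ) : MatH →ₗ[ℝ] MatH →ₗ[ℝ] ℝ :=
  LinearMap.mk₂ ℝ (fun a b => r₁ / 2 * inner ℝ (a 0 0) (b 0 0) + inner ℝ (a 0 1) (b 0 1)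
      + r₂ / 2 * inner ℝ (a 1 1) (b 1 1))
    (fun a a' b => by simp only [Matrix.add_apply, inner_add_left]; ring)
    (fun c a b => by simp only [Matrix.smul_apply, real_inner_smul_left, smul_eq_mul]; ring)
    (fun a b b' => by simp only [Matrix.add_apply, inner_add_right]; ring)
    (fun c a b => by simp only [Matrix.smul_apply, real_inner_smul_right, smul_eq_mul]; ring)

/-- The Levi-Civita product `Λ(a, b) = (∇_a b)(I)` of left-invariant vector fields for `g_r`. For
`a` and `b` in `𝔰𝔭(2)` it is the solution of the Koszul formula; only the entries `x`, `y`, `z` of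
`a` and `b` are used, so that it is defined on all of `M(2, ℍ)`. -/
def lcProduct (r₁ r₂ : ℝ) : MatH →ₗ[ℝ] MatH →ₗ[ℝ] MatH :=
  LinearMap.mk₂ ℝ (fun a b => mk
      ((1 / 2 : ℝ) • (a 0 0 * b 0 0 - b 0 0 * a 0 0 - a 0 1 * star (b 0 1) + b 0 1 * star (a 0 1)))
      ((1 - r₁ / 2) • (a 0 0 * b 0 1) - (r₁ / 2) • (b 0 0 * a 0 1)
        + (r₂ / 2) • (a 0 1 * b 1 1) - (1 - r₂ / 2) • (b 0 1 * a 1 1))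
      ((1 / 2 : ℝ) • (a 1 1 * b 1 1 - b 1 1 * a 1 1 - star (a 0 1) * b 0 1 + star (b 0 1) * a 0 1)))
    (fun a a' b => by
      simp only [Matrix.add_apply, mk_add, star_add, mul_add, add_mul]
      congr 1 <;> module)
    (fun c a b => by
      simp only [Matrix.smul_apply, mk_smul, Quaternion.star_smul, mul_smul_comm, smul_mul_assoc]
      congr 1 <;> module)
    (fun a b b' => by
      simp only [Matrix.add_apply, mk_add, star_add, mul_add, add_mul]
      congr 1 <;> module)
    (fun c a b => by
      simp only [Matrix.smul_apply, mk_smul, Quaternion.star_smul, mul_smul_comm, smul_mul_assoc]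
      congr 1 <;> module)

variable {r₁ r₂ : ℝ}

theorem form_mk (x y z x' y' z' : ℍ[ℝ]) : form r₁ r₂ (mk x y z) (mk x' y' z')
    = r₁ / 2 * inner ℝ x x' + inner ℝ y y' + r₂ / 2 * inner ℝ z z' := rfl

theorem lcProduct_mk (x y z x' y' z' : ℍ[ℝ]) : lcProduct r₁ r₂ (mk x y z) (mk x' y' z')
    = mk ((1 / 2 : ℝ) • (x * x' - x' * x - y * star y' + y' * star y))
      ((1 - r₁ / 2) • (x * y') - (r₁ / 2) • (x' * y)
        + (r₂ / 2) • (y * z') - (1 - r₂ / 2) • (y' * z))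
      ((1 / 2 : ℝ) • (z * z' - z' * z - star y * y' + star y' * y)) := rfl

theorem lcProduct_mem {a b : MatH} (ha : a ∈ sp2) (hb : b ∈ sp2) : lcProduct r₁ r₂ a b ∈ sp2 := by
  obtain ⟨x, y, z, hx, hz, rfl⟩ := exists_eq_mk ha
  obtain ⟨x', y', z', hx', hz', rfl⟩ := exists_eq_mk hb
  rw [lcProduct_mk]
  refine mk_mem_sp2 ?_ _ ?_ <;> simp <;> ring

theorem lcProduct_sub_lcProduct {a b : MatH} (ha : a ∈ sp2) (hb : b ∈ sp2) :
    lcProduct r₁ r₂ a b - lcProduct r₁ r₂ b a = a * b - b * a := by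
  obtain ⟨x, y, z, hx, hz, rfl⟩ := exists_eq_mk ha
  obtain ⟨x', y', z', hx', hz', rfl⟩ := exists_eq_mk hb
  rw [lcProduct_mk, lcProduct_mk, mk_sub, mk_commutator _ _ hx hz hx' hz']
  congr 1 <;> module

theorem form_lcProduct {a b c : MatH} (ha : a ∈ sp2) (hb : b ∈ sp2) (hc : c ∈ sp2) :
    form r₁ r₂ (lcProduct r₁ r₂ a b) c + form r₁ r₂ b (lcProduct r₁ r₂ a c) = 0 := by
  obtain ⟨x, y, z, hx, hz, rfl⟩ := exists_eq_mk ha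
  obtain ⟨x', y', z', hx', hz', rfl⟩ := exists_eq_mk hb
  obtain ⟨x'', y'', z'', hx'', hz'', rfl⟩ := exists_eq_mk hc
  simp only [lcProduct_mk, form_mk, Quaternion.inner_def]
  simp [hx, hz, hx', hz', hx'', hz'']
  ring

theorem form_comm (a b : MatH) : form r₁ r₂ a b = form r₁ r₂ b a := by
  simp only [form, LinearMap.mk₂_apply, real_inner_comm]

theorem eq_zero_of_form_self (hr₁ : 0 < r₁) (hr₂ : 0 < r₂) {a : MatH} (ha : a ∈ sp2)
    (h : form r₁ r₂ a a = 0) : a = 0 := by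
  obtain ⟨x, y, z, hx, hz, rfl⟩ := exists_eq_mk ha
  rw [form_mk] at h
  have h1 : 0 ≤ r₁ / 2 * inner ℝ x x := mul_nonneg (by positivity) real_inner_self_nonneg
  have h2 : (0 : ℝ) ≤ inner ℝ y y := real_inner_self_nonneg
  have h3 : 0 ≤ r₂ / 2 * inner ℝ z z := mul_nonneg (by positivity) real_inner_self_nonneg
  have hx0 : r₁ / 2 * inner ℝ x x = 0 := by linarith
  have hy0 : (inner ℝ y y : ℝ) = 0 := by linarith
  have hz0 : r₂ / 2 * inner ℝ z z = 0 := by linarith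
  rw [mul_eq_zero_iff_left (by positivity), inner_self_eq_zero] at hx0 hz0
  rw [inner_self_eq_zero] at hy0
  subst hx0 hy0 hz0
  ext1 i j
  fin_cases i <;> fin_cases j <;> simp [mk]

end SpTwo

namespace SpTwo

section

attribute [local instance] Matrix.linftyOpNormedRing Matrix.linftyOpNormedAlgebra

/-! ### The Levi-Civita connection on `Sp(2)` -/

instance : StarModule ℝ MatH where
  star_smul c A := by
    ext1 i j
    simp [Matrix.star_apply]

theorem metric_eq_form (r₁ r₂ : ℝ) (Q v w : MatH) :
    metric r₁ r₂ Q v w = form r₁ r₂ (star Q * v) (star Q * w) := rfl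

theorem star_mul_mul {Q : MatH} (hQ : Q ∈ Sp2) (A : MatH) : star Q * (Q * A) = A := by
  rw [← mul_assoc, Unitary.star_mul_self_of_mem hQ, one_mul]

theorem mul_star_mul {Q : MatH} (hQ : Q ∈ Sp2) (A : MatH) : Q * (star Q * A) = A := by
  rw [← mul_assoc, Unitary.mul_star_self_of_mem hQ, one_mul]

theorem star_mul_mem_sp2 {Q v : MatH} (hQ : Q ∈ Sp2) (hv : v ∈ tangentSpace Q) :
    star Q * v ∈ sp2 := by
  obtain ⟨A, hA, rfl⟩ := hv
  exact (star_mul_mul hQ A).symm ▸ hA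

theorem mul_mem_tangentSpace (Q : MatH) {A : MatH} (hA : A ∈ sp2) : Q * A ∈ tangentSpace Q :=
  ⟨A, hA, rfl⟩

theorem isField_iff {X : MatH → MatH} : UnitaryConnection.IsField X ↔ IsVectorField X := by
  refine ⟨fun h => ⟨h.smooth, fun Q hQ => ?_⟩, fun h => ⟨h.smooth, fun Q hQ => ?_⟩⟩
  · rw [← mul_star_mul hQ (X Q)]
    exact mul_mem_tangentSpace Q (h.skew Q hQ)
  · exact star_mul_mem_sp2 hQ (h.tangent Q hQ)

theorem exists_isLeviCivita (r₁ r₂ : ℝ) : ∃ nabla, IsLeviCivita (metric r₁ r₂) nabla := by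
  open UnitaryConnection in
  refine ⟨connection (lcProduct r₁ r₂), ⟨fun X Y hX hY => ?_, fun X X' Y hX hX' hY Q hQ => ?_,
    fun f X Y hf hX hY Q hQ => ?_, fun X Y Y' hX hY hY' Q hQ => ?_,
    fun f X Y hf hX hY Q hQ => ?_, fun X Y hX hY Q hQ => ?_, fun X Y Z hX hY hZ Q hQ => ?_⟩⟩
  · exact isField_iff.1 (isField_connection (fun a ha b hb => lcProduct_mem ha hb)
      (isField_iff.2 hX) (isField_iff.2 hY))
  · exact connection_add_left
  · exact connection_smul_left f
  · exact connection_add_right (isField_iff.2 hY) (isField_iff.2 hY')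
  · exact connection_leibniz hf (isField_iff.2 hY) hQ
  · exact connection_torsion_free (fun a ha b hb => lcProduct_sub_lcProduct ha hb)
      (isField_iff.2 hX) (isField_iff.2 hY) hQ
  · exact connection_metric_compatible (fun a ha b hb c hc => form_lcProduct ha hb hc)
      (isField_iff.2 hX) (isField_iff.2 hY) (isField_iff.2 hZ) hQ

/-! ### Uniqueness and the curvature tensor -/

/-- The left-invariant vector field with value `a` at the identity. -/
def leftField (a : MatH) : MatH → MatH := fun P => P * a

theorem isVectorField_leftField {a : MatH} (ha : a ∈ sp2) : IsVectorField (leftField a) :=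
  ⟨contDiff_id.mul contDiff_const, fun Q _ => mul_mem_tangentSpace Q ha⟩

theorem lieBracket_leftField (a b : MatH) :
    VectorField.lieBracket ℝ (leftField a) (leftField b) = leftField (a * b - b * a) := by
  funext P
  refine (congrArg₂ (· - ·) (UnitaryConnection.fderiv_mul_const_apply b P (leftField a P))
    (UnitaryConnection.fderiv_mul_const_apply a P (leftField b P))).trans ?_
  simp only [leftField]
  noncomm_ring

theorem commutator_mem {a b : MatH} (ha : a ∈ sp2) (hb : b ∈ sp2) : a * b - b * a ∈ sp2 := by
  rw [← lcProduct_sub_lcProduct (r₁ := 1) (r₂ := 1) ha hb]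
  exact sub_mem (lcProduct_mem ha hb) (lcProduct_mem hb ha)

theorem fderiv_metric_eq_zero {r₁ r₂ : ℝ} {Y Z : MatH → MatH} (hY : IsVectorField Y)
    (hZ : IsVectorField Z) {c : ℝ} (hc : ∀ P ∈ Sp2, metric r₁ r₂ P (Y P) (Z P) = c) {Q v : MatH}
    (hQ : Q ∈ Sp2) (hv : v ∈ tangentSpace Q) :
    fderiv ℝ (fun P => metric r₁ r₂ P (Y P) (Z P)) Q v = 0 := by
  obtain ⟨A, hA, rfl⟩ := hv
  have hd : DifferentiableAt ℝ (fun P => metric r₁ r₂ P (Y P) (Z P)) Q :=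
    UnitaryConnection.differentiableAt_form (form r₁ r₂) hY.smooth hZ.smooth
  have h := UnitaryConnection.fderiv_congr_of_unitary (G := fun _ => c) hc hd
    (differentiableAt_const c) hQ hA
  rw [fderiv_fun_const] at h
  exact h

variable {r₁ r₂ : ℝ} {nabla : (MatH → MatH) → (MatH → MatH) → (MatH → MatH)}

theorem eq_zero_of_metric_eq_zero (hr₁ : 0 < r₁) (hr₂ : 0 < r₂) {Q v : MatH} (hQ : Q ∈ Sp2)
    (hv : v ∈ tangentSpace Q) (h : metric r₁ r₂ Q v v = 0) : v = 0 := by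
  rw [← mul_star_mul hQ v, eq_zero_of_form_self hr₁ hr₂ (star_mul_mem_sp2 hQ hv) h, mul_zero]

/-- `∇_X Y` on `Sp(2)` only depends on the values of `Y` on `Sp(2)`: by metric compatibility, a
field `W` vanishing there satisfies `g(∇_X W, Z) = X g(W, Z) - g(W, ∇_X Z) = 0`. -/
theorem IsLeviCivita.congr_right (h : IsLeviCivita (metric r₁ r₂) nabla) (hr₁ : 0 < r₁)
    (hr₂ : 0 < r₂) {X Y Y' : MatH → MatH} (hX : IsVectorField X) (hY : IsVectorField Y)
    (hY' : IsVectorField Y') (heq : ∀ P ∈ Sp2, Y P = Y' P) {Q : MatH} (hQ : Q ∈ Sp2) :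
    nabla X Y Q = nabla X Y' Q := by
  have hW : IsVectorField (Y - Y') := ⟨hY.smooth.sub hY'.smooth, fun P hP =>
    sub_mem (hY.tangent P hP) (hY'.tangent P hP)⟩
  have hW0 (P) (hP : P ∈ Sp2) : (Y - Y') P = 0 := sub_eq_zero.2 (heq P hP)
  have h1 := (h.isVectorField X _ hX hW)
  have h2 := h.metric_compatible X (Y - Y') _ hX hW h1 Q hQ
  rw [fderiv_metric_eq_zero hW h1 (c := 0) (fun P hP => by
    rw [hW0 P hP, metric_eq_form, mul_zero, map_zero, LinearMap.zero_apply]) hQ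
    (hX.tangent Q hQ), hW0 Q hQ, metric_eq_form _ _ _ 0, mul_zero, map_zero, LinearMap.zero_apply,
    add_zero] at h2
  have h3 := eq_zero_of_metric_eq_zero hr₁ hr₂ hQ (h1.tangent Q hQ) h2.symm
  have h4 := h.add_right X Y' (Y - Y') hX hY' hW Q hQ
  rwa [add_sub_cancel, h3, add_zero] at h4

/-- A Levi-Civita connection is given on left-invariant fields by the product `Λ`: the difference
of the two is a trilinear form that is symmetric in the first two arguments and skew in the last
two. -/
theorem IsLeviCivita.nabla_leftField (h : IsLeviCivita (metric r₁ r₂) nabla) (hr₁ : 0 < r₁)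
    (hr₂ : 0 < r₂) {a b Q : MatH} (ha : a ∈ sp2) (hb : b ∈ sp2) (hQ : Q ∈ Sp2) :
    nabla (leftField a) (leftField b) Q = Q * lcProduct r₁ r₂ a b := by
  set T : MatH → MatH → MatH := fun a b =>
    star Q * nabla (leftField a) (leftField b) Q - lcProduct r₁ r₂ a b with hT
  have hfield {a : MatH} (ha : a ∈ sp2) := isVectorField_leftField ha
  have hTmem {a b : MatH} (ha : a ∈ sp2) (hb : b ∈ sp2) : T a b ∈ sp2 :=
    sub_mem (star_mul_mem_sp2 hQ ((h.isVectorField _ _ (hfield ha) (hfield hb)).tangent Q hQ))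
      (lcProduct_mem ha hb)
  have hsymm {a b : MatH} (ha : a ∈ sp2) (hb : b ∈ sp2) : T a b = T b a := by
    have h1 := h.torsion_free _ _ (hfield ha) (hfield hb) Q hQ
    rw [lieBracket_leftField, leftField, ← lcProduct_sub_lcProduct (r₁ := r₁) (r₂ := r₂) ha hb,
      sub_eq_iff_eq_add] at h1
    simp only [hT, h1, mul_add, star_mul_mul hQ]
    abel
  have hskew {a b c : MatH} (ha : a ∈ sp2) (hb : b ∈ sp2) (hc : c ∈ sp2) :
      form r₁ r₂ (T a b) c + form r₁ r₂ b (T a c) = 0 := by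
    have h1 := h.metric_compatible _ _ _ (hfield ha) (hfield hb) (hfield hc) Q hQ
    rw [fderiv_metric_eq_zero (hfield hb) (hfield hc) (c := form r₁ r₂ b c) (fun P hP => by
      rw [metric_eq_form, leftField, leftField, star_mul_mul hP, star_mul_mul hP]) hQ
      ((hfield ha).tangent Q hQ), metric_eq_form, metric_eq_form] at h1
    simp only [leftField, star_mul_mul hQ] at h1
    have h2 := form_lcProduct (r₁ := r₁) (r₂ := r₂) ha hb hc
    simp only [hT, map_sub, LinearMap.sub_apply]
    linarith
  have hzero : form r₁ r₂ (T a b) (T a b) = 0 := by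
    -- Alternating the two symmetries gives `τ(a, b, c) = -τ(a, b, c)` for the trilinear form `τ`.
    have key {a b c : MatH} (ha : a ∈ sp2) (hb : b ∈ sp2) (hc : c ∈ sp2) :
        form r₁ r₂ (T a b) c = 0 := by
      have h1 := hskew ha hb hc
      have h2 := hskew hc ha hb
      have h3 := hskew hb hc ha
      rw [form_comm b, hsymm ha hc] at h1
      rw [form_comm a, hsymm hc hb] at h2
      rw [form_comm c, hsymm hb ha] at h3
      linarith
    exact key ha hb (hTmem ha hb)
  have h1 := sub_eq_zero.1 (eq_zero_of_form_self hr₁ hr₂ (hTmem ha hb) hzero)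
  rw [← h1, mul_star_mul hQ]

/-- The curvature of the metric at the identity,
`R(a, b) c = Λ(a, Λ(b, c)) - Λ(b, Λ(a, c)) - Λ([a, b], c)`. -/
def curv (r₁ r₂ : ℝ) (a b c : MatH) : MatH :=
  lcProduct r₁ r₂ a (lcProduct r₁ r₂ b c) - lcProduct r₁ r₂ b (lcProduct r₁ r₂ a c)
    - lcProduct r₁ r₂ (a * b - b * a) c

theorem IsLeviCivita.curvatureTensor_eq (h : IsLeviCivita (metric r₁ r₂) nabla) (hr₁ : 0 < r₁)
    (hr₂ : 0 < r₂) {Q u v w : MatH} (hQ : Q ∈ Sp2) (hu : u ∈ tangentSpace Q)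
    (hv : v ∈ tangentSpace Q) (hw : w ∈ tangentSpace Q) :
    curvatureTensor nabla Q u v w = Q * curv r₁ r₂ (star Q * u) (star Q * v) (star Q * w) := by
  have key {a b c : MatH} (ha : a ∈ sp2) (hb : b ∈ sp2) (hc : c ∈ sp2) :
      nabla (leftField a) (nabla (leftField b) (leftField c)) Q
        = Q * lcProduct r₁ r₂ a (lcProduct r₁ r₂ b c) := by
    rw [← h.nabla_leftField hr₁ hr₂ ha (lcProduct_mem hb hc) hQ]
    exact h.congr_right hr₁ hr₂ (isVectorField_leftField ha)
      (h.isVectorField _ _ (isVectorField_leftField hb) (isVectorField_leftField hc))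
      (isVectorField_leftField (lcProduct_mem hb hc)) (fun P hP => h.nabla_leftField hr₁ hr₂ hb hc hP) hQ
  have ha := star_mul_mem_sp2 hQ hu
  have hb := star_mul_mem_sp2 hQ hv
  have hc := star_mul_mem_sp2 hQ hw
  change nabla (leftField (star Q * u)) (nabla (leftField (star Q * v))
      (leftField (star Q * w))) Q - nabla (leftField (star Q * v))
      (nabla (leftField (star Q * u)) (leftField (star Q * w))) Q
    - nabla (VectorField.lieBracket ℝ (leftField (star Q * u))
      (leftField (star Q * v))) (leftField (star Q * w)) Q = _
  rw [key ha hb hc, key hb ha hc, lieBracket_leftField,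
    h.nabla_leftField hr₁ hr₂ (commutator_mem ha hb) hc hQ, curv, mul_sub, mul_sub]

end

end SpTwo

namespace SpTwo

/-! ### Sectional curvature -/

variable {r₁ r₂ : ℝ}

theorem form_curv_eq {a b : MatH} (ha : a ∈ sp2) (hb : b ∈ sp2) :
    form r₁ r₂ (curv r₁ r₂ a b b) a
      = form r₁ r₂ (lcProduct r₁ r₂ a b) (lcProduct r₁ r₂ b a)
        - form r₁ r₂ (lcProduct r₁ r₂ b b) (lcProduct r₁ r₂ a a)
        - form r₁ r₂ (lcProduct r₁ r₂ (a * b - b * a) b) a := by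
  have h1 := form_lcProduct (r₁ := r₁) (r₂ := r₂) ha (lcProduct_mem (r₁ := r₁) (r₂ := r₂) hb hb) ha
  have h2 := form_lcProduct (r₁ := r₁) (r₂ := r₂) hb (lcProduct_mem (r₁ := r₁) (r₂ := r₂) ha hb) ha
  simp only [curv, map_sub, LinearMap.sub_apply] at *
  linarith

/-- The numerator of the sectional curvature. The last term combines the contributions of `x` and
`z`, as `|y' ȳ - y ȳ'| = |ȳ' y - ȳ y'|`. -/
theorem form_curv_mk {x y z x' y' z' : ℍ[ℝ]} (hx : x.re = 0) (hz : z.re = 0) (hx' : x'.re = 0)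
    (hz' : z'.re = 0) :
    form r₁ r₂ (curv r₁ r₂ (mk x y z) (mk x' y' z') (mk x' y' z')) (mk x y z)
      = r₁ / 8 * ‖x * x' - x' * x + (3 - 2 * r₁) • (y' * star y - y * star y')‖ ^ 2
        + r₂ / 8 * ‖z * z' - z' * z + (3 - 2 * r₂) • (star y' * y - star y * y')‖ ^ 2
        + 1 / 4 * ‖r₁ • (x * y' - x' * y) + r₂ • (y * z' - y' * z)‖ ^ 2
        + ((1 - r₁) ^ 3 + (1 - r₂) ^ 3) / 2 * ‖y' * star y - y * star y'‖ ^ 2 := by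
  rw [form_curv_eq (mk_mem_sp2 hx y hz) (mk_mem_sp2 hx' y' hz'), mk_commutator _ _ hx hz hx' hz']
  simp only [lcProduct_mk, form_mk, ← real_inner_self_eq_norm_sq, Quaternion.inner_def]
  simp [hx, hz, hx', hz']
  ring

end SpTwo

namespace SpTwo

variable {r₁ r₂ : ℝ} {nabla : (MatH → MatH) → (MatH → MatH) → (MatH → MatH)}

theorem form_self_pos (hr₁ : 0 < r₁) (hr₂ : 0 < r₂) {a : MatH} (ha : a ∈ sp2) (h : a ≠ 0) :
    0 < form r₁ r₂ a a := by
  refine lt_of_le_of_ne' ?_ fun h0 => h (eq_zero_of_form_self hr₁ hr₂ ha h0)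
  obtain ⟨x, y, z, -, -, rfl⟩ := exists_eq_mk ha
  rw [form_mk]
  simp only [real_inner_self_eq_norm_sq]
  positivity

/-- The denominator of the sectional curvature is positive, by the Cauchy-Schwarz inequality. -/
theorem metric_gram_pos (hr₁ : 0 < r₁) (hr₂ : 0 < r₂) {Q u v : MatH} (hQ : Q ∈ Sp2)
    (hu : u ∈ tangentSpace Q) (hv : v ∈ tangentSpace Q) (h : LinearIndependent ℝ ![u, v]) :
    0 < metric r₁ r₂ Q u u * metric r₁ r₂ Q v v - metric r₁ r₂ Q u v ^ 2 := by
  simp only [metric_eq_form]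
  set a := star Q * u with ha
  set b := star Q * v with hb
  have hne {w : MatH} (hw : w ≠ 0) : star Q * w ≠ 0 := fun h0 => hw <| by
    rw [← mul_star_mul hQ w, h0, mul_zero]
  have ham : a ∈ sp2 := star_mul_mem_sp2 hQ hu
  have hbm : b ∈ sp2 := star_mul_mem_sp2 hQ hv
  have hpos : 0 < form r₁ r₂ b b := form_self_pos hr₁ hr₂ hbm (hne (by simpa using h.ne_zero 1))
  have hab : form r₁ r₂ b b • a - form r₁ r₂ a b • b ≠ 0 := by
    rw [ha, hb, ← mul_smul_comm, ← mul_smul_comm, ← mul_sub]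
    refine hne fun h0 => ?_
    rw [sub_eq_add_neg, ← neg_smul] at h0
    exact hpos.ne' (LinearIndependent.pair_iff.1 h _ _ h0).1
  have h2 := form_self_pos hr₁ hr₂ (sub_mem (sp2.smul_mem _ ham) (sp2.smul_mem _ hbm)) hab
  simp only [map_sub, map_smul, LinearMap.sub_apply, LinearMap.smul_apply, smul_eq_mul,
    form_comm b a] at h2
  -- `h2` is the positivity of the form at `g(v, v) u - g(u, v) v`, which is `g(v, v)` times the goal.
  refine pos_of_mul_pos_right (a := form r₁ r₂ b b) ?_ hpos.le
  linarith

theorem IsLeviCivita.sectionalCurvature_nonneg_iff (h : IsLeviCivita (metric r₁ r₂) nabla)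
    (hr₁ : 0 < r₁) (hr₂ : 0 < r₂) {Q u v : MatH} (hQ : Q ∈ Sp2)
    (hu : u ∈ tangentSpace Q) (hv : v ∈ tangentSpace Q) (hi : LinearIndependent ℝ ![u, v]) :
    0 ≤ sectionalCurvature (metric r₁ r₂) nabla Q u v ↔
      0 ≤ form r₁ r₂ (curv r₁ r₂ (star Q * u) (star Q * v) (star Q * v)) (star Q * u) := by
  rw [sectionalCurvature, le_div_iff₀ (metric_gram_pos hr₁ hr₂ hQ hu hv hi), zero_mul,
    h.curvatureTensor_eq hr₁ hr₂ hQ hu hv hv, metric_eq_form, star_mul_mul hQ]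

theorem exists_add_eq_mul_eq {s p : ℝ} (h : 4 * p ≤ s ^ 2) : ∃ α β, α + β = s ∧ α * β = p := by
  refine ⟨(s + √(s ^ 2 - 4 * p)) / 2, (s - √(s ^ 2 - 4 * p)) / 2, by ring, ?_⟩
  have := Real.sq_sqrt (sub_nonneg.2 h)
  linear_combination -this / 4

/-- A plane on which the three squares in `form_curv_mk` vanish, while the last term does not. The
real numbers `α`, `β`, `γ`, `δ` solve `αβ = 2r₁ - 3`, `γδ = 2r₂ - 3` and
`r₁ (α + β) = r₂ (γ + δ)`; the common value of the last two has to be large. -/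
theorem exists_form_curv_eq (hr₁ : 0 < r₁) (hr₂ : 0 < r₂) :
    ∃ a ∈ sp2, ∃ b ∈ sp2, LinearIndependent ℝ ![a, b] ∧
      form r₁ r₂ (curv r₁ r₂ a b b) a = 2 * ((1 - r₁) ^ 3 + (1 - r₂) ^ 3) := by
  -- The sums `α + β = T / r₁` and `γ + δ = T / r₂` with `T = 2 (r₁² + r₂²)` are large enough for
  -- the quadratic equations to have real roots.
  have hdisc {r s : ℝ} (hr : 0 < r) : 4 * (2 * r - 3) ≤ (2 * (r ^ 2 + s ^ 2) / r) ^ 2 := by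
    have h1 : 2 * r ≤ 2 * (r ^ 2 + s ^ 2) / r := by
      rw [le_div_iff₀ hr]
      nlinarith [sq_nonneg s]
    nlinarith [sq_nonneg (r - 1), mul_self_le_mul_self (by positivity) h1]
  obtain ⟨α, β, h1, h2⟩ := exists_add_eq_mul_eq (hdisc (s := r₂) hr₁)
  obtain ⟨γ, δ, h3, h4⟩ := exists_add_eq_mul_eq (hdisc (s := r₁) hr₂)
  have h5 : r₁ * (α + β) = r₂ * (γ + δ) := by
    rw [h1, h3, mul_div_cancel₀ _ hr₁.ne', mul_div_cancel₀ _ hr₂.ne', add_comm]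
  refine ⟨mk (quat 0 0 α 0) (quat 1 0 0 0) (quat 0 0 (-γ) 0), mk_mem_sp2 rfl _ rfl,
    mk (quat 0 0 0 β) (quat 0 1 0 0) (quat 0 0 0 δ), mk_mem_sp2 rfl _ rfl, ?_, ?_⟩
  · rw [LinearIndependent.pair_iff]
    intro s t hst
    have h01 := congrFun (congrFun hst 0) 1
    simpa [Quaternion.ext_iff] using h01
  · rw [form_curv_mk rfl rfl rfl rfl]
    simp only [← real_inner_self_eq_norm_sq, Quaternion.inner_def]
    simp
    linear_combination r₁ / 2 * (α * β + 3 - 2 * r₁) * h2 + r₂ / 2 * (γ * δ + 3 - 2 * r₂) * h4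
      + 1 / 4 * (r₁ * (α + β) - r₂ * (γ + δ)) * h5

theorem IsLeviCivita.nonnegSectionalCurvature_iff (h : IsLeviCivita (metric r₁ r₂) nabla)
    (hr₁ : 0 < r₁) (hr₂ : 0 < r₂) :
    NonnegSectionalCurvature (metric r₁ r₂) nabla ↔ r₁ + r₂ ≤ 2 := by
  have hcube : (1 - r₁) ^ 3 + (1 - r₂) ^ 3 = (2 - (r₁ + r₂))
      * (((1 - r₁) ^ 2 + (1 - r₂) ^ 2 + (r₁ - r₂) ^ 2) / 2) := by ring
  constructor
  · intro hn
    obtain ⟨a, ha, b, hb, hi, hab⟩ := exists_form_curv_eq hr₁ hr₂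
    have hmem {c : MatH} (hc : c ∈ sp2) : c ∈ tangentSpace 1 :=
      one_mul c ▸ mul_mem_tangentSpace 1 hc
    have h1 := hn 1 (one_mem _) a (hmem ha) b (hmem hb) hi
    rw [h.sectionalCurvature_nonneg_iff hr₁ hr₂ (one_mem _) (hmem ha) (hmem hb) hi, star_one,
      one_mul, one_mul, hab, hcube] at h1
    by_contra! h2
    have h3 : 0 < ((1 - r₁) ^ 2 + (1 - r₂) ^ 2 + (r₁ - r₂) ^ 2) / 2 := by
      nlinarith [sq_nonneg (r₁ - r₂), mul_self_nonneg (r₁ + r₂ - 2)]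
    nlinarith
  · intro hr Q hQ u hu v hv hi
    rw [h.sectionalCurvature_nonneg_iff hr₁ hr₂ hQ hu hv hi]
    obtain ⟨x, y, z, hx, hz, ha⟩ := exists_eq_mk (star_mul_mem_sp2 hQ hu)
    obtain ⟨x', y', z', hx', hz', hb⟩ := exists_eq_mk (star_mul_mem_sp2 hQ hv)
    have h0 : 0 ≤ 2 - (r₁ + r₂) := sub_nonneg.2 hr
    rw [ha, hb, form_curv_mk hx hz hx' hz', hcube]
    positivity

/-! ### Ricci curvature -/

/-- The element of `𝔰𝔭(2)` with given real coordinates. -/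
def ofCoords (c : Fin 10 → ℝ) : MatH :=
  mk (quat 0 (c 0) (c 1) (c 2)) (quat (c 3) (c 4) (c 5) (c 6)) (quat 0 (c 7) (c 8) (c 9))

/-- The ten real coordinates of an element of `𝔰𝔭(2)`. -/
def coords (A : MatH) : Fin 10 → ℝ :=
  ![(A 0 0).imI, (A 0 0).imJ, (A 0 0).imK, (A 0 1).re, (A 0 1).imI, (A 0 1).imJ, (A 0 1).imK,
    (A 1 1).imI, (A 1 1).imJ, (A 1 1).imK]

theorem coords_ofCoords (c : Fin 10 → ℝ) : coords (ofCoords c) = c := by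
  funext i
  fin_cases i <;> rfl

theorem ofCoords_coords {A : MatH} (hA : A ∈ sp2) : ofCoords (coords A) = A := by
  obtain ⟨x, y, z, hx, hz, rfl⟩ := exists_eq_mk hA
  rw [ofCoords]
  congr 1
  · ext <;> simp [coords, hx]
  · ext <;> simp [coords, hz]

theorem ofCoords_mem (c : Fin 10 → ℝ) : ofCoords c ∈ sp2 := mk_mem_sp2 rfl _ rfl

/-- Real coordinates on the tangent space `T_Q Sp(2)`, by left translation. -/
def tangentEquiv {Q : MatH} (hQ : Q ∈ Sp2) : tangentSpace Q ≃ₗ[ℝ] (Fin 10 → ℝ) where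
  toFun v := coords (star Q * v)
  invFun c := ⟨Q * ofCoords c, mul_mem_tangentSpace Q (ofCoords_mem c)⟩
  map_add' v w := by
    funext i
    fin_cases i <;> simp [coords, mul_add]
  map_smul' c v := by
    funext i
    fin_cases i <;> simp [coords]
  left_inv v := Subtype.ext <| by
    simp only [ofCoords_coords (star_mul_mem_sp2 hQ v.2), mul_star_mul hQ]
  right_inv c := by simp only [star_mul_mul hQ, coords_ofCoords]

theorem trace_eq_sum_coords {Q : MatH} (hQ : Q ∈ Sp2) (T : Module.End ℝ (tangentSpace Q)) :
    LinearMap.trace ℝ (tangentSpace Q) T = ∑ i, coords (star Q *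
      (T ⟨Q * ofCoords (Pi.single i 1), mul_mem_tangentSpace Q (ofCoords_mem _)⟩ : MatH)) i := by
  rw [← LinearMap.trace_conj' T (tangentEquiv hQ),
    LinearMap.trace_eq_matrix_trace ℝ (Pi.basisFun ℝ (Fin 10)), Matrix.trace]
  refine Finset.sum_congr rfl fun i _ => ?_
  rw [Matrix.diag_apply, LinearMap.toMatrix_apply, Pi.basisFun_apply, Pi.basisFun_repr]
  rfl

/-- The part of the Ricci tensor coming from the directions `x`. -/
theorem trace_curv_x {x y z x' y' z' : ℍ[ℝ]} (hx : x.re = 0) (hz : z.re = 0)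
    (hx' : x'.re = 0) :
    (curv r₁ r₂ (mk (quat 0 1 0 0) 0 0) (mk x y z) (mk x' y' z') 0 0).imI
      + (curv r₁ r₂ (mk (quat 0 0 1 0) 0 0) (mk x y z) (mk x' y' z') 0 0).imJ
      + (curv r₁ r₂ (mk (quat 0 0 0 1) 0 0) (mk x y z) (mk x' y' z') 0 0).imK
      = 2 * inner ℝ x x' + 3 / 2 * r₁ * inner ℝ y y' := by
  simp only [curv, mk_commutator _ _ (quat_re _ _ _ _) Quaternion.re_zero hx hz, lcProduct_mk,
    mk_sub, mk_apply₀₀, Quaternion.inner_def]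
  simp [hx, hx']
  ring

/-- The part of the Ricci tensor coming from the directions `z`. -/
theorem trace_curv_z {x y z x' y' z' : ℍ[ℝ]} (hx : x.re = 0) (hz : z.re = 0)
    (hz' : z'.re = 0) :
    (curv r₁ r₂ (mk 0 0 (quat 0 1 0 0)) (mk x y z) (mk x' y' z') 1 1).imI
      + (curv r₁ r₂ (mk 0 0 (quat 0 0 1 0)) (mk x y z) (mk x' y' z') 1 1).imJ
      + (curv r₁ r₂ (mk 0 0 (quat 0 0 0 1)) (mk x y z) (mk x' y' z') 1 1).imK
      = 2 * inner ℝ z z' + 3 / 2 * r₂ * inner ℝ y y' := by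
  simp only [curv, mk_commutator _ _ Quaternion.re_zero (quat_re _ _ _ _) hx hz, lcProduct_mk,
    mk_sub, mk_apply₁₁, Quaternion.inner_def]
  simp [hz, hz']
  ring

/-- The part of the Ricci tensor coming from the directions `y`. -/
theorem trace_curv_y {x y z x' y' z' : ℍ[ℝ]} (hx : x.re = 0) (hz : z.re = 0)
    (hx' : x'.re = 0) (hz' : z'.re = 0) :
    (curv r₁ r₂ (mk 0 (quat 1 0 0 0) 0) (mk x y z) (mk x' y' z') 0 1).re
      + (curv r₁ r₂ (mk 0 (quat 0 1 0 0) 0) (mk x y z) (mk x' y' z') 0 1).imI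
      + (curv r₁ r₂ (mk 0 (quat 0 0 1 0) 0) (mk x y z) (mk x' y' z') 0 1).imJ
      + (curv r₁ r₂ (mk 0 (quat 0 0 0 1) 0) (mk x y z) (mk x' y' z') 0 1).imK
      = r₁ ^ 2 * inner ℝ x x' + (12 - 9 / 2 * (r₁ + r₂)) * inner ℝ y y'
        + r₂ ^ 2 * inner ℝ z z' := by
  simp only [curv, mk_commutator _ _ Quaternion.re_zero Quaternion.re_zero hx hz, lcProduct_mk,
    mk_sub, mk_apply₀₁, Quaternion.inner_def]
  simp [hx, hz, hx', hz']
  ring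

/-- The Ricci tensor at the identity, diagonal in the decomposition of `𝔰𝔭(2)` into `x`, `y`
and `z`. -/
theorem sum_coords_curv {b c : MatH} (hb : b ∈ sp2) (hc : c ∈ sp2) :
    ∑ i, coords (curv r₁ r₂ (ofCoords (Pi.single i 1)) b c) i
      = (2 + r₁ ^ 2) * inner ℝ (b 0 0) (c 0 0)
        + (12 - 3 * (r₁ + r₂)) * inner ℝ (b 0 1) (c 0 1)
        + (2 + r₂ ^ 2) * inner ℝ (b 1 1) (c 1 1) := by
  obtain ⟨x, y, z, hx, hz, rfl⟩ := exists_eq_mk hb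
  obtain ⟨x', y', z', hx', hz', rfl⟩ := exists_eq_mk hc
  have h0 : quat 0 0 0 0 = 0 := rfl
  have h1 := trace_curv_x (r₁ := r₁) (r₂ := r₂) (y := y) (y' := y') (z' := z') hx hz hx'
  have h2 := trace_curv_y (r₁ := r₁) (r₂ := r₂) (y := y) (y' := y') hx hz hx' hz'
  have h3 := trace_curv_z (r₁ := r₁) (r₂ := r₂) (y := y) (y' := y') (x' := x') hx hz hz'
  simp only [Fin.sum_univ_succ, ofCoords, coords]
  simp [Pi.single_apply, h0]
  linarith

/-- The endomorphism `u ↦ R(u, v) w` of `T_Q Sp(2)`, whose trace is the Ricci tensor. -/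
def ricciOperator (r₁ r₂ : ℝ) {Q v w : MatH} (hQ : Q ∈ Sp2) (hv : v ∈ tangentSpace Q)
    (hw : w ∈ tangentSpace Q) : Module.End ℝ (tangentSpace Q) where
  toFun u := ⟨Q * curv r₁ r₂ (star Q * u) (star Q * v) (star Q * w), by
    have ha := star_mul_mem_sp2 hQ u.2
    have hb := star_mul_mem_sp2 hQ hv
    have hc := star_mul_mem_sp2 hQ hw
    exact mul_mem_tangentSpace Q (sub_mem (sub_mem (lcProduct_mem ha (lcProduct_mem hb hc))
      (lcProduct_mem hb (lcProduct_mem ha hc))) (lcProduct_mem (commutator_mem ha hb) hc))⟩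
  map_add' u u' := Subtype.ext <| by
    simp only [curv, Submodule.coe_add, mul_add, add_mul, map_add, map_sub, LinearMap.add_apply,
      LinearMap.sub_apply, mul_sub]
    abel
  map_smul' c u := Subtype.ext <| by
    simp only [curv, Submodule.coe_smul, mul_smul_comm, smul_mul_assoc, map_smul, map_sub,
      LinearMap.smul_apply, LinearMap.sub_apply, mul_sub, smul_sub, RingHom.id_apply]

theorem IsLeviCivita.hasRicci_iff (h : IsLeviCivita (metric r₁ r₂) nabla) (hr₁ : 0 < r₁)
    (hr₂ : 0 < r₂) {Q v w : MatH} (hQ : Q ∈ Sp2) (hv : v ∈ tangentSpace Q)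
    (hw : w ∈ tangentSpace Q) {ρ : ℝ} : HasRicci nabla Q v w ρ ↔
      (2 + r₁ ^ 2) * inner ℝ ((star Q * v) 0 0) ((star Q * w) 0 0)
        + (12 - 3 * (r₁ + r₂)) * inner ℝ ((star Q * v) 0 1) ((star Q * w) 0 1)
        + (2 + r₂ ^ 2) * inner ℝ ((star Q * v) 1 1) ((star Q * w) 1 1) = ρ := by
  have key (T : Module.End ℝ (tangentSpace Q))
      (hT : ∀ u : tangentSpace Q, (T u : MatH) = curvatureTensor nabla Q u v w) :
      LinearMap.trace ℝ (tangentSpace Q) T = (2 + r₁ ^ 2) * inner ℝ ((star Q * v) 0 0)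
        ((star Q * w) 0 0) + (12 - 3 * (r₁ + r₂)) * inner ℝ ((star Q * v) 0 1) ((star Q * w) 0 1)
        + (2 + r₂ ^ 2) * inner ℝ ((star Q * v) 1 1) ((star Q * w) 1 1) := by
    rw [trace_eq_sum_coords hQ, ← sum_coords_curv (star_mul_mem_sp2 hQ hv) (star_mul_mem_sp2 hQ hw)]
    refine Finset.sum_congr rfl fun i _ => ?_
    rw [hT, h.curvatureTensor_eq hr₁ hr₂ hQ (Subtype.coe_prop _) hv hw]
    simp only [star_mul_mul hQ]
  constructor
  · rintro ⟨T, hT, rfl⟩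
    exact (key T hT).symm
  · rintro rfl
    exact ⟨ricciOperator r₁ r₂ hQ hv hw,
      fun u => (h.curvatureTensor_eq hr₁ hr₂ hQ u.2 hv hw).symm,
      key _ fun u => (h.curvatureTensor_eq hr₁ hr₂ hQ u.2 hv hw).symm⟩

theorem einstein_constants_iff (hr₁ : 0 < r₁) (hr₂ : 0 < r₂) :
    (∃ c : ℝ, 2 + r₁ ^ 2 = c * (r₁ / 2) ∧ 12 - 3 * (r₁ + r₂) = c ∧ 2 + r₂ ^ 2 = c * (r₂ / 2)) ↔
      (r₁ = 1 ∧ r₂ = 1) ∨ (r₁ = 1 / 2 ∧ r₂ = 1 / 2) := by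
  constructor
  · rintro ⟨c, h1, h2, h3⟩
    have h4 : (r₁ - r₂) * (r₁ * r₂ - 2) = 0 := by linear_combination r₂ * h1 - r₁ * h3
    have hr : r₁ = r₂ := by
      refine sub_eq_zero.1 ((mul_eq_zero.1 h4).resolve_right fun h5 => ?_)
      -- `r₁ r₂ = 2` gives `c = 2 (r₁ + r₂)`, hence `r₁ + r₂ = 12 / 5 < 2 √2`.
      have h6 : c = 2 * (r₁ + r₂) := by
        refine mul_right_cancel₀ hr₁.ne' ?_
        linear_combination -2 * h1 - 2 * h5
      have h7 : r₁ + r₂ = 12 / 5 := by linarith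
      nlinarith [sq_nonneg (r₁ - r₂)]
    subst hr
    have h5 : (r₁ - 1) * (r₁ - 1 / 2) = 0 := by
      subst h2
      linear_combination h1 / 4
    rcases mul_eq_zero.1 h5 with h6 | h6
    · exact Or.inl ⟨sub_eq_zero.1 h6, sub_eq_zero.1 h6⟩
    · exact Or.inr ⟨sub_eq_zero.1 h6, sub_eq_zero.1 h6⟩
  · rintro (⟨rfl, rfl⟩ | ⟨rfl, rfl⟩)
    · exact ⟨6, by norm_num, by norm_num, by norm_num⟩
    · exact ⟨9, by norm_num, by norm_num, by norm_num⟩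

theorem IsLeviCivita.isEinstein_iff (h : IsLeviCivita (metric r₁ r₂) nabla) (hr₁ : 0 < r₁)
    (hr₂ : 0 < r₂) : IsEinstein (metric r₁ r₂) nabla ↔
      (r₁ = 1 ∧ r₂ = 1) ∨ (r₁ = 1 / 2 ∧ r₂ = 1 / 2) := by
  rw [← einstein_constants_iff hr₁ hr₂]
  constructor
  · rintro ⟨c, hc⟩
    have key {a : MatH} (ha : a ∈ sp2) := by
      have hmem : a ∈ tangentSpace 1 := one_mul a ▸ mul_mem_tangentSpace 1 ha
      have h1 := hc 1 (one_mem _) a hmem a hmem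
      rw [h.hasRicci_iff hr₁ hr₂ (one_mem _) hmem hmem, metric_eq_form, star_one, one_mul] at h1
      exact h1
    have h1 := key (mk_mem_sp2 (x := quat 0 1 0 0) rfl 0 (z := 0) rfl)
    have h2 := key (mk_mem_sp2 (x := 0) rfl 1 (z := 0) rfl)
    have h3 := key (mk_mem_sp2 (x := 0) rfl 0 (z := quat 0 1 0 0) rfl)
    simp only [form_mk, mk_apply₀₀, mk_apply₀₁, mk_apply₁₁, Quaternion.inner_def] at h1 h2 h3
    simp at h1 h2 h3
    exact ⟨c, h1, h2, h3⟩
  · rintro ⟨c, h1, h2, h3⟩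
    refine ⟨c, fun Q hQ v hv w hw => ?_⟩
    rw [h.hasRicci_iff hr₁ hr₂ hQ hv hw, h1, h2, h3, metric_eq_form]
    simp only [form, LinearMap.mk₂_apply]
    ring

end SpTwo

end

theorem theorem1p1 (r₁ r₂ : ℝ) (hr₁ : 0 < r₁) (hr₂ : 0 < r₂) :
    (∃ nabla, SpTwo.IsLeviCivita (SpTwo.metric r₁ r₂) nabla) ∧
    ∀ nabla, SpTwo.IsLeviCivita (SpTwo.metric r₁ r₂) nabla →
      (SpTwo.NonnegSectionalCurvature (SpTwo.metric r₁ r₂) nabla ↔ r₁ + r₂ ≤ 2) ∧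
      (SpTwo.IsEinstein (SpTwo.metric r₁ r₂) nabla ↔
        (r₁ = 1 ∧ r₂ = 1) ∨ (r₁ = 1 / 2 ∧ r₂ = 1 / 2)) :=
  ⟨SpTwo.exists_isLeviCivita r₁ r₂, fun _ h =>
    ⟨h.nonnegSectionalCurvature_iff hr₁ hr₂, h.isEinstein_iff hr₁ hr₂⟩⟩
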